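/- **Notation.** $H(\mathbb C)$ is the space of entire functions with the topology of locally uniform convergence. For $a\in\mathbb C$ let $T_a:H(\mathbb C)\to H(\mathbb C)$ be the translation operator $T_a f(z)=f(z+a)$. For a sequence $(T_n)$ of continuous linear operators on a topological vector space $X$, $HC(\{T_n\})$ is the set of all $x\in X$ for which $\{T_nx: n\ge 1\}$ is dense in $X$. For a sequence $\Lambda=(\lambda_n)$ of non-zero complex numbers, $$i(\Lambda)=\inf\Big\{\limsup_{n\to\infty}\Big|\frac{\mu_{n+1}}{\mu_n}\Big| \;:\; (\mu_n)\text{ a subsequence of }\Lambda\Big\}\in[0,+\infty],$$ and $\Lambda$ satisfies condition $(\Sigma)$ if for every real $C>0$ there is a subsequence $(\mu_n)$ of $\Lambda$ such that $|\mu_{n+1}|-|\mu_n|>C$ for every $n\ge1$ and $\sum_{n=1}^{\infty}\frac1{|\mu_n|}=+\infty$. **Proposition.** For every real number $M>1$ there is a strictly increasing sequence $\Lambda=(\lambda_n)$ of positive real numbers with $\lambda_n\to+\infty$ such that $i(\Lambda)=M$, $\Lambda$ satisfies condition $(\Sigma)$, and $$\bigcap_{a\in\mathbb C\setminus\{0\}}HC(\{T_{\lambda_na}\})$$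 is a dense $G_\delta$ subset of $H(\mathbb C)$. -/

import Mathlib

open Filter Topology

/-- The space `H(ℂ)` of entire functions, as a subspace of the space `C(ℂ, ℂ)` of continuous
functions; it carries the subspace topology of the compact-open topology, which is the topology
of locally uniform convergence. -/
noncomputable def EntireFunctions : Submodule ℂ C(ℂ, ℂ) where
  carrier := {f | Differentiable ℂ (f : ℂ → ℂ)}
  add_mem' := fun {f g} (hf : Differentiable ℂ f) (hg : Differentiable ℂ g) => hf.add hg
  zero_mem' := (differentiable_const (0 : ℂ) : Differentiable ℂ fun _ : ℂ => (0 : ℂ))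
  smul_mem' := fun c f (hf : Differentiable ℂ f) => hf.const_smul c

/-- The translation operator `T_a : H(ℂ) → H(ℂ)`, `T_a f (z) = f (z + a)`. -/
noncomputable def translationOp (a : ℂ) : EntireFunctions →L[ℂ] EntireFunctions where
  toFun f := ⟨f.1.comp ⟨fun z => z + a, continuous_add_const a⟩, by
    have hf : Differentiable ℂ (f.1 : ℂ → ℂ) := f.2
    exact hf.comp (differentiable_id.add_const a)⟩
  map_add' _ _ := rfl
  map_smul' _ _ := rfl
  cont := by
    refine Continuous.subtype_mk ?_ _
    exact (ContinuousMap.continuous_precomp _).comp continuous_subtype_val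

/-- The set `HC({T_n})` of hypercyclic vectors of a sequence `(T_n)` of continuous linear
operators on `X`: the vectors `x` for which `{T_n x : n}` is dense in `X`. -/
def hypercyclicVectors {𝕜 X : Type*} [Field 𝕜] [AddCommGroup X] [Module 𝕜 X]
    [TopologicalSpace X] (T : ℕ → X →L[𝕜] X) : Set X :=
  {x | Dense (Set.range fun n => T n x)}

/-- Condition `(Σ)`: for every `M > 0` there is a subsequence `(μ_n)` of `(lam n)` with
`|μ_{n+1}| - |μ_n| > M` for all `n` and `∑ 1 / |μ_n| = +∞`. -/
def ConditionSigma (lam : ℕ → ℂ) : Prop :=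
  ∀ M : ℝ, 0 < M → ∃ φ : ℕ → ℕ, StrictMono φ ∧
    (∀ n, M < ‖lam (φ (n + 1))‖ - ‖lam (φ n)‖) ∧
    Tendsto (fun N => ∑ n ∈ Finset.range N, 1 / ‖lam (φ n)‖) atTop atTop

/-- The set of all `a ∈ [0, +∞]` with `a = limsup |μ_{n+1} / μ_n|` for some subsequence `(μ_n)`
of the sequence `(lam n)` of non-zero complex numbers. -/
def ratioLimsups (lam : ℕ → ℂ) : Set ENNReal :=
  {a | ∃ φ : ℕ → ℕ, StrictMono φ ∧
    a = limsup (fun n => ‖lam (φ (n + 1)) / lam (φ n)‖ₑ) atTop}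

/-- The index `i(Λ) ∈ [0, +∞]`, the infimum of `limsup |μ_{n+1} / μ_n|` over all subsequences. -/
noncomputable def ratioIndex (lam : ℕ → ℂ) : ENNReal := sInf (ratioLimsups lam)

/-- The set `⋂_{a ≠ 0} HC({T_{lam n * a}})` of common hypercyclic vectors. -/
def commonHypercyclicVectors (lam : ℕ → ℂ) : Set EntireFunctions :=
  ⋂ a ∈ {a : ℂ | a ≠ 0},
    hypercyclicVectors (𝕜 := ℂ) (X := EntireFunctions) fun n => translationOp (lam n * a)

/-! The sequence consists of the square roots of the integers in very long blocks. Between blocks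
the integers jump by a factor about `M ^ 2`, so their roots jump by about `M`; every subsequence
crosses infinitely many gaps, while the full sequence has no larger jump in the limit, so the index
is exactly `M`. Inside a block starting at `s` the roots have spacing tending to `0`, and they fill
`[s, (k + 2) * s]`, whose endpoint ratio is unbounded. Multiples of an integer `D` in these
intervals give condition (Σ).

For common hypercyclicity, Baire's theorem leaves a finite problem: given `g`, `h` and a compact
cone of directions `b`, find one entire `f` close to `g` on a disc and having, for each `b`, a
translate by some `λ * b` close to `h` (`exists_entire_approx`). Place copies of `h` at finitely
many points of a logarithmic spiral whose slopes sweep the cone (`exists_spiral_points`). The ratio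
`Q` of outer to inner radius does not depend on the inner radius, so the lengths `λ` needed all fit
in one late block (`exists_dilates_near_spiral`). The copies are glued by Gaussian factors, with an
error independent of their number (`exists_entire_approx_on_spaced_discs`). -/

/-- First index of the `k`-th block of integers; consecutive blocks are separated by a gap of
ratio (asymptotically) `M ^ 2`. -/
noncomputable def blockStart (M : ℝ) : ℕ → ℕ
  | 0 => 1
  | k + 1 => ⌈M ^ 2 * ((((k + 2) * blockStart M k) ^ 2 : ℕ) : ℝ)⌉₊

/-- Last index of the `k`-th block. -/
noncomputable def blockStop (M : ℝ) (k : ℕ) : ℕ := ((k + 2) * blockStart M k) ^ 2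

/-- `m` belongs to one of the blocks. -/
def InBlock (M : ℝ) (m : ℕ) : Prop := ∃ k, blockStart M k ≤ m ∧ m ≤ blockStop M k

/-- The increasing enumeration of the square roots of the integers lying in the blocks. -/
noncomputable def sqrtBlockSeq (M : ℝ) (n : ℕ) : ℝ := √(Nat.nth (InBlock M) n : ℝ)

/-! ### The block sequence: its index and condition (Σ) -/

section Blocks

variable {M : ℝ}

theorem blockStart_succ (k : ℕ) : blockStart M (k + 1) = ⌈M ^ 2 * (blockStop M k : ℝ)⌉₊ := rfl

theorem sq_mul_blockStop_le (k : ℕ) : M ^ 2 * (blockStop M k : ℝ) ≤ blockStart M (k + 1) := by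
  rw [blockStart_succ]; exact Nat.le_ceil _

theorem blockStart_succ_le (k : ℕ) :
    (blockStart M (k + 1) : ℝ) ≤ M ^ 2 * (blockStop M k : ℝ) + 1 := by
  rw [blockStart_succ]; exact (Nat.ceil_lt_add_one (by positivity)).le

theorem blockStart_pos (hM : 1 < M) (k : ℕ) : 0 < blockStart M k := by
  induction k with
  | zero => exact one_pos
  | succ k ih =>
    have h : 0 < blockStop M k := by unfold blockStop; positivity
    rw [blockStart_succ, Nat.ceil_pos]
    positivity

theorem lt_blockStop (hM : 1 < M) (k : ℕ) : k < blockStop M k := by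
  have := blockStart_pos hM k
  unfold blockStop
  nlinarith [Nat.mul_le_mul_left (k + 2) this]

theorem blockStart_le_blockStop (hM : 1 < M) (k : ℕ) : blockStart M k ≤ blockStop M k := by
  have := blockStart_pos hM k
  unfold blockStop
  calc blockStart M k ≤ (k + 2) * blockStart M k := Nat.le_mul_of_pos_left _ (by omega)
    _ ≤ _ := Nat.le_self_pow (by norm_num) _

theorem blockStop_lt_blockStart_succ (hM : 1 < M) (k : ℕ) :
    blockStop M k < blockStart M (k + 1) := by
  have h : (0 : ℝ) < blockStop M k := by exact_mod_cast (Nat.zero_le k).trans_lt (lt_blockStop hM k)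
  have := sq_mul_blockStop_le (M := M) k
  have : (blockStop M k : ℝ) < blockStart M (k + 1) := by nlinarith [mul_pos (sub_pos.2 hM) h]
  exact_mod_cast this

theorem blockStart_strictMono (hM : 1 < M) : StrictMono (blockStart M) :=
  strictMono_nat_of_lt_succ fun k =>
    (blockStart_le_blockStop hM k).trans_lt (blockStop_lt_blockStart_succ hM k)

theorem blockStop_strictMono (hM : 1 < M) : StrictMono (blockStop M) :=
  strictMono_nat_of_lt_succ fun k =>
    (blockStop_lt_blockStart_succ hM k).trans_le (blockStart_le_blockStop hM (k + 1))

theorem InBlock.pos (hM : 1 < M) {m : ℕ} (h : InBlock M m) : 0 < m := by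
  obtain ⟨k, hk, -⟩ := h
  exact (blockStart_pos hM k).trans_le hk

theorem infinite_inBlock (hM : 1 < M) : (Set.ofPred (InBlock M)).Infinite :=
  Set.infinite_of_injective_forall_mem (blockStop_strictMono hM).injective
    fun k => ⟨k, blockStart_le_blockStop hM k, le_rfl⟩

theorem InBlock.blockStart_succ_le (hM : 1 < M) {m k : ℕ} (h : InBlock M m)
    (hk : blockStop M k < m) : blockStart M (k + 1) ≤ m := by
  obtain ⟨j, hj, hj'⟩ := h
  have hkj : k < j := (blockStop_strictMono hM).lt_iff_lt.1 (hk.trans_le hj')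
  exact ((blockStart_strictMono hM).monotone hkj).trans hj

theorem InBlock.exists_next (hM : 1 < M) {m : ℕ} (h : InBlock M m) :
    ∃ m', InBlock M m' ∧ m < m' ∧ (m' : ℝ) ≤ M ^ 2 * m + 1 := by
  obtain ⟨k, hk, hk'⟩ := h
  rcases hk'.lt_or_eq with h | h
  · refine ⟨m + 1, ⟨k, by omega, h⟩, by omega, ?_⟩
    push_cast
    have : (0 : ℝ) ≤ m := m.cast_nonneg
    nlinarith [mul_nonneg (sub_pos.2 hM).le this]
  · subst h
    exact ⟨blockStart M (k + 1), ⟨k + 1, le_rfl, blockStart_le_blockStop hM _⟩,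
      blockStop_lt_blockStart_succ hM k, _root_.blockStart_succ_le k⟩

theorem inBlock_nth (hM : 1 < M) (n : ℕ) : InBlock M (Nat.nth (InBlock M) n) :=
  Nat.nth_mem_of_infinite (infinite_inBlock hM) n

theorem nth_inBlock_succ_le (hM : 1 < M) (n : ℕ) :
    (Nat.nth (InBlock M) (n + 1) : ℝ) ≤ M ^ 2 * Nat.nth (InBlock M) n + 1 := by
  obtain ⟨m', h, hlt, hle⟩ := (inBlock_nth hM n).exists_next hM
  refine le_trans ?_ hle
  by_contra! hcon
  exact hlt.not_ge (Nat.le_nth_of_lt_nth_succ (by exact_mod_cast hcon) h)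

theorem sqrtBlockSeq_strictMono (hM : 1 < M) : StrictMono (sqrtBlockSeq M) := fun _ _ h =>
  Real.sqrt_lt_sqrt (Nat.cast_nonneg _)
    (by exact_mod_cast Nat.nth_strictMono (infinite_inBlock hM) h)

theorem sqrtBlockSeq_pos (hM : 1 < M) (n : ℕ) : 0 < sqrtBlockSeq M n :=
  Real.sqrt_pos.2 (by exact_mod_cast (inBlock_nth hM n).pos hM)

theorem tendsto_nth_inBlock (hM : 1 < M) :
    Tendsto (fun n => (Nat.nth (InBlock M) n : ℝ)) atTop atTop :=
  tendsto_natCast_atTop_atTop.comp (Nat.nth_strictMono (infinite_inBlock hM)).tendsto_atTop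

theorem tendsto_sqrtBlockSeq (hM : 1 < M) : Tendsto (sqrtBlockSeq M) atTop atTop :=
  Real.tendsto_sqrt_atTop.comp (tendsto_nth_inBlock hM)

theorem exists_sqrtBlockSeq_eq {m : ℕ} (h : InBlock M m) : ∃ n, sqrtBlockSeq M n = √m := by
  classical
  exact ⟨Nat.count (InBlock M) m, by rw [sqrtBlockSeq, Nat.nth_count h]⟩

theorem enorm_ofReal_div_ofReal {x y : ℝ} (hx : 0 < x) (hy : 0 < y) :
    ‖(x : ℂ) / (y : ℂ)‖ₑ = ENNReal.ofReal (x / y) := by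
  rw [← Complex.ofReal_div, ← ofReal_norm, Complex.norm_real, Real.norm_eq_abs,
    abs_of_pos (div_pos hx hy)]

/-- A subsequence must step over every late gap, and one step over a gap multiplies the integer by
at least `M ^ 2`. -/
theorem le_limsup_ratio_sqrtBlockSeq (hM : 1 < M) {φ : ℕ → ℕ} (hφ : StrictMono φ) :
    ENNReal.ofReal M ≤ limsup (fun n =>
      ‖(sqrtBlockSeq M (φ (n + 1)) : ℂ) / (sqrtBlockSeq M (φ n) : ℂ)‖ₑ) atTop := by
  refine le_limsup_of_frequently_le' (frequently_atTop.2 fun N => ?_)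
  set m : ℕ → ℕ := fun n => Nat.nth (InBlock M) (φ n) with hm
  have hmono : StrictMono m := (Nat.nth_strictMono (infinite_inBlock hM)).comp hφ
  have hk := lt_blockStop hM (m N)
  -- Block number `m N` ends beyond `m N`, so the first term past its end has index greater than
  -- `N`.
  set t := blockStop M (m N) with ht
  have hex : ∃ n, t < m n := ⟨t + 1, (Nat.lt_succ_self t).trans_le (hmono.id_le _)⟩
  classical
  have hspec := Nat.find_spec hex
  have hN : N < Nat.find hex := hmono.lt_iff_lt.1 (hk.trans hspec)
  obtain ⟨n, hn⟩ : ∃ n, Nat.find hex = n + 1 := ⟨Nat.find hex - 1, by omega⟩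
  have hle : m n ≤ t := not_lt.1 (Nat.find_min hex (by omega))
  rw [hn] at hspec
  refine ⟨n, by omega, ?_⟩
  rw [enorm_ofReal_div_ofReal (sqrtBlockSeq_pos hM _) (sqrtBlockSeq_pos hM _)]
  refine ENNReal.ofReal_le_ofReal ?_
  rw [le_div_iff₀ (sqrtBlockSeq_pos hM _)]
  have h1 : (blockStart M (m N + 1) : ℝ) ≤ m (n + 1) := by
    exact_mod_cast (inBlock_nth hM (φ (n + 1))).blockStart_succ_le hM hspec
  have h2 := sq_mul_blockStop_le (M := M) (m N)
  have h3 : (m n : ℝ) ≤ t := by exact_mod_cast hle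
  calc M * sqrtBlockSeq M (φ n) = √(M ^ 2 * m n) := by
        rw [Real.sqrt_mul (sq_nonneg M), Real.sqrt_sq (by linarith)]; rfl
    _ ≤ √(m (n + 1)) := Real.sqrt_le_sqrt (by nlinarith [sq_nonneg M])

theorem limsup_ratio_sqrtBlockSeq_le (hM : 1 < M) :
    limsup (fun n => ‖(sqrtBlockSeq M (n + 1) : ℂ) / (sqrtBlockSeq M n : ℂ)‖ₑ) atTop
      ≤ ENNReal.ofReal M := by
  have hlim : Tendsto (fun n => ENNReal.ofReal √(M ^ 2 + (Nat.nth (InBlock M) n : ℝ)⁻¹)) atTop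
      (𝓝 (ENNReal.ofReal M)) := by
    refine ENNReal.tendsto_ofReal ?_
    have h := ((tendsto_nth_inBlock hM).inv_tendsto_atTop.const_add (M ^ 2)).sqrt
    rwa [add_zero, Real.sqrt_sq (by linarith)] at h
  rw [← hlim.limsup_eq]
  refine limsup_le_limsup (Eventually.of_forall fun n => ?_)
  simp only
  rw [enorm_ofReal_div_ofReal (sqrtBlockSeq_pos hM _) (sqrtBlockSeq_pos hM _), sqrtBlockSeq,
    sqrtBlockSeq, ← Real.sqrt_div (Nat.cast_nonneg _)]
  have hpos : (0 : ℝ) < Nat.nth (InBlock M) n := by exact_mod_cast (inBlock_nth hM n).pos hM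
  refine ENNReal.ofReal_le_ofReal (Real.sqrt_le_sqrt ?_)
  rw [div_le_iff₀ hpos, add_mul, inv_mul_cancel₀ hpos.ne']
  exact nth_inBlock_succ_le hM n

theorem ratioIndex_sqrtBlockSeq (hM : 1 < M) :
    ratioIndex (fun n => (sqrtBlockSeq M n : ℂ)) = ENNReal.ofReal M := by
  refine le_antisymm ?_ (le_sInf ?_)
  · exact (sInf_le (show _ ∈ ratioLimsups _ from ⟨id, strictMono_id, rfl⟩)).trans (limsup_ratio_sqrtBlockSeq_le hM)
  · rintro a ⟨φ, hφ, rfl⟩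
    exact le_limsup_ratio_sqrtBlockSeq hM hφ

theorem inBlock_sq {k m : ℕ} (h1 : blockStart M k ≤ m)
    (h2 : m ≤ (k + 2) * blockStart M k) : InBlock M (m ^ 2) :=
  ⟨k, h1.trans (Nat.le_self_pow (by norm_num) _), Nat.pow_le_pow_left h2 2⟩

/-- A set of positive integers containing infinitely many intervals `(u, 2u]` has divergent sum
of reciprocals. -/
theorem not_summable_indicator_inv {P : ℕ → Prop}
    (hP : ∀ N : ℕ, ∃ u > N, ∀ j, u < j → j ≤ 2 * u → P j) :
    ¬ Summable (Set.indicator (Set.ofPred P) fun j : ℕ => (j : ℝ)⁻¹) := by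
  intro h
  -- Each interval `(u, 2u]` contributes at least `u * (1 / (2u)) = 1 / 2`.
  obtain ⟨s, hs⟩ := summable_iff_vanishing_norm.1 h (1 / 2) (by norm_num)
  obtain ⟨u, hu, huP⟩ := hP (s.sup id)
  have hd : Disjoint (Finset.Ioc u (2 * u)) s := by
    rw [Finset.disjoint_left]
    intro j hj hjs
    have := Finset.le_sup (f := id) hjs
    simp only [Finset.mem_Ioc, id] at hj this
    omega
  have hlt := (le_abs_self _).trans_lt (hs _ hd)
  have hu0 : (0 : ℝ) < u := by exact_mod_cast (Nat.zero_le _).trans_lt hu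
  have hge : ∑ j ∈ Finset.Ioc u (2 * u), (2 * (u : ℝ))⁻¹ ≤
      ∑ j ∈ Finset.Ioc u (2 * u), Set.indicator (Set.ofPred P) (fun j : ℕ => (j : ℝ)⁻¹) j := by
    refine Finset.sum_le_sum fun j hj => ?_
    rw [Finset.mem_Ioc] at hj
    rw [Set.indicator_of_mem (show j ∈ Set.ofPred P from huP j hj.1 hj.2)]
    have h1 : (0 : ℝ) < j := by exact_mod_cast (Nat.zero_le _).trans_lt hj.1
    have h2 : (j : ℝ) ≤ 2 * u := by exact_mod_cast hj.2
    exact inv_anti₀ h1 h2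
  rw [Finset.sum_const, Nat.card_Ioc, nsmul_eq_mul, show 2 * u - u = u by omega] at hge
  have : (u : ℝ) * (2 * (u : ℝ))⁻¹ = 1 / 2 := by field_simp
  linarith

theorem conditionSigma_sqrtBlockSeq (hM : 1 < M) :
    ConditionSigma (fun n => (sqrtBlockSeq M n : ℂ)) := by
  intro C hC
  classical
  obtain ⟨D, hD⟩ := exists_nat_gt C
  have hD0 : 0 < D := by exact_mod_cast hC.trans hD
  -- The subsequence consists of the multiples `D * j` occurring in the sequence; they are at least
  -- `D > C` apart.
  set P : ℕ → Prop := fun j => InBlock M ((D * j) ^ 2) with hPdef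
  have hP : ∀ N : ℕ, ∃ u > N, ∀ j, u < j → j ≤ 2 * u → P j := by
    intro N
    -- With `2 * D ≤ k`, block `k + 1` is long enough to contain `(D * j) ^ 2` for all `j` in `(u,
    -- 2u]`.
    set k := max N (2 * D) with hk
    have hs : k < blockStart M (k + 1) := by
      have := (blockStart_strictMono hM).id_le k
      exact (show k ≤ _ from this).trans_lt (blockStart_strictMono hM (Nat.lt_succ_self k))
    refine ⟨blockStart M (k + 1), by omega, fun j h1 h2 => inBlock_sq (k := k + 1) ?_ ?_⟩
    · exact h1.le.trans (Nat.le_mul_of_pos_left _ hD0)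
    · calc D * j ≤ D * (2 * blockStart M (k + 1)) := Nat.mul_le_mul_left _ h2
        _ = 2 * D * blockStart M (k + 1) := by ring
        _ ≤ _ := Nat.mul_le_mul_right _ (by omega)
  have hPinf : (Set.ofPred P).Infinite := by
    rw [Set.infinite_iff_exists_gt]
    intro N
    obtain ⟨u, hu, h⟩ := hP N
    exact ⟨2 * u, h _ (by omega) le_rfl, by omega⟩
  set ψ := Nat.nth P with hψ
  have hψm : StrictMono ψ := Nat.nth_strictMono hPinf
  have hψP : ∀ n, InBlock M ((D * ψ n) ^ 2) := Nat.nth_mem_of_infinite hPinf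
  have hval : ∀ n, ‖((sqrtBlockSeq M (Nat.count (InBlock M) ((D * ψ n) ^ 2)) : ℝ) : ℂ)‖
      = D * ψ n := by
    intro n
    rw [sqrtBlockSeq, Nat.nth_count (hψP n)]
    push_cast
    rw [Real.sqrt_sq (by positivity), Complex.norm_real, Real.norm_eq_abs,
      abs_of_nonneg (by positivity)]
  refine ⟨fun n => Nat.count (InBlock M) ((D * ψ n) ^ 2), ?_, fun n => ?_, ?_⟩
  · intro a b hab
    refine Nat.count_strict_mono (hψP a) ?_
    exact Nat.pow_lt_pow_left (Nat.mul_lt_mul_of_pos_left (hψm hab) hD0) (by norm_num)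
  · simp only [hval]
    have h1 : (ψ n : ℝ) + 1 ≤ ψ (n + 1) := by exact_mod_cast hψm (Nat.lt_succ_self n)
    have h2 : (0 : ℝ) < D := by exact_mod_cast hD0
    nlinarith
  · simp only [hval]
    refine (not_summable_iff_tendsto_nat_atTop_of_nonneg fun n => by positivity).1 fun h => ?_
    refine not_summable_indicator_inv hP ?_
    rw [← hψm.injective.summable_iff]
    · refine (h.mul_left (D : ℝ)).congr fun n => ?_
      have : (0 : ℝ) < D := by exact_mod_cast hD0
      rw [Function.comp_apply, Set.indicator_of_mem (show ψ n ∈ Set.ofPred P from hψP n)]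
      field_simp
    · intro x hx
      refine Set.indicator_of_notMem (fun hxP => hx ?_) _
      rw [hψ, Nat.range_nth_of_infinite hPinf]
      exact hxP

/-- The terms coming from a late block are dense in a long interval. -/
theorem exists_sqrtBlockSeq_near (hM : 1 < M) {k : ℕ} {y : ℝ} (h1 : (blockStart M k : ℝ) ≤ y)
    (h2 : y ≤ (k + 2) * blockStart M k) : ∃ n, |sqrtBlockSeq M n - y| ≤ 1 / y := by
  have hs : (1 : ℝ) ≤ blockStart M k := by exact_mod_cast blockStart_pos hM k
  have hy : 1 ≤ y := hs.trans h1
  have hfl : (⌊y ^ 2⌋₊ : ℝ) ≤ y ^ 2 := Nat.floor_le (by positivity)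
  have hfl' : y ^ 2 < ⌊y ^ 2⌋₊ + 1 := Nat.lt_floor_add_one _
  -- The witness is `√⌊y ^ 2⌋₊`: the squares differ by less than `1`, hence the roots by at most `1
  -- / y`.
  have hin : InBlock M ⌊y ^ 2⌋₊ := by
    refine ⟨k, Nat.le_floor (h1.trans (by nlinarith)), ?_⟩
    have : (⌊y ^ 2⌋₊ : ℝ) ≤ (blockStop M k : ℝ) := by
      refine hfl.trans ?_
      unfold blockStop
      push_cast
      exact pow_le_pow_left₀ (by linarith) h2 2
    exact_mod_cast this
  obtain ⟨n, hn⟩ := exists_sqrtBlockSeq_eq hin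
  refine ⟨n, ?_⟩
  rw [hn]
  set q : ℝ := (⌊y ^ 2⌋₊ : ℝ)
  have hq0 : 0 ≤ √q := Real.sqrt_nonneg _
  have hqsq : √q ^ 2 = q := Real.sq_sqrt (Nat.cast_nonneg _)
  have hle : √q ≤ y := by
    rw [← Real.sqrt_sq (show 0 ≤ y by linarith)]; exact Real.sqrt_le_sqrt hfl
  rw [abs_sub_comm, abs_of_nonneg (by linarith), le_div_iff₀ (by linarith)]
  nlinarith

end Blocks

/-! ### Gluing entire functions with Gaussian factors -/

theorem exists_forall_sum_exp_neg_abs_le :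
    ∃ B > 0, ∀ (s : Finset ℕ) (j : ℕ), ∑ i ∈ s, Real.exp (-|(j : ℝ) - i|) ≤ B := by
  have hsum : Summable fun k : ℤ => Real.exp (-|(k : ℝ)|) := by
    refine Summable.of_nat_of_neg ?_ ?_ <;> simpa using Real.summable_exp_neg_nat
  refine ⟨(∑' k : ℤ, Real.exp (-|(k : ℝ)|)) + 1, ?_, fun s j => ?_⟩
  · have := tsum_nonneg (L := .unconditional ℤ) fun k : ℤ => (Real.exp_pos (-|(k : ℝ)|)).le
    linarith
  · have hinj : Function.Injective fun i : ℕ => (j : ℤ) - i := fun a b h => by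
      simp only at h; omega
    have h := hsum.sum_le_tsum (s.map ⟨_, hinj⟩) fun _ _ => (Real.exp_pos _).le
    rw [Finset.sum_map] at h
    simp only [Function.Embedding.coeFn_mk, Int.cast_sub, Int.cast_natCast] at h
    linarith

/-- In a cone around the real axis, the Gaussian decays faster than any exponential grows. -/
theorem exists_exp_norm_mul_gaussian_le {κ r : ℝ} (hκ : 0 < κ) (hr : 0 ≤ r) :
    ∃ X₀ : ℝ, ∀ v z : ℂ, X₀ ≤ |v.re| → |v.im| ≤ |v.re| / 2 → ‖z‖ ≤ r →
      Real.exp ‖v + z‖ * ‖Complex.exp (-κ * (v + z) ^ 2)‖ ≤ Real.exp (-|v.re|) := by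
  -- Here `Re (v + z) ^ 2 ≥ 3/4 X ^ 2 - 3 r X` and `‖v + z‖ ≤ 2 X + r`, where `X = |v.re|`; the
  -- threshold makes the quadratic term win with `X` to spare.
  refine ⟨r + 1 + 4 * (3 + r + 3 * κ * r) / (3 * κ), fun v z hX him hz => ?_⟩
  rw [Complex.norm_exp, ← Real.exp_add]
  refine Real.exp_le_exp.2 ?_
  set X := |v.re| with hXdef
  have hq : 0 ≤ 4 * (3 + r + 3 * κ * r) / (3 * κ) := by positivity
  have hX1 : r + 1 ≤ X := by linarith
  have hX2 : 3 + r + 3 * κ * r ≤ 3 / 4 * κ * X := by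
    have : 4 * (3 + r + 3 * κ * r) / (3 * κ) ≤ X := by linarith
    rw [div_le_iff₀ (by positivity)] at this
    linarith
  have hzr := (Complex.abs_re_le_norm z).trans hz
  have hzi := (Complex.abs_im_le_norm z).trans hz
  have hre : (X - r) ^ 2 ≤ (v + z).re ^ 2 := by
    rw [← sq_abs (v + z).re]
    refine pow_le_pow_left₀ (by linarith) ?_ 2
    have : X ≤ |(v + z).re| + |z.re| := by
      have := abs_sub (v + z).re z.re
      simpa [hXdef] using this
    linarith
  have him' : (v + z).im ^ 2 ≤ (X / 2 + r) ^ 2 := by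
    rw [← sq_abs (v + z).im]
    refine pow_le_pow_left₀ (abs_nonneg _) ?_ 2
    have := abs_add_le v.im z.im
    rw [Complex.add_im]
    linarith
  have hnorm : ‖v + z‖ ≤ 2 * X + r := by
    have h1 := norm_add_le v z
    have h2 := Complex.norm_le_abs_re_add_abs_im v
    linarith
  have hexp : (-(κ : ℂ) * (v + z) ^ 2).re = -κ * ((v + z).re ^ 2 - (v + z).im ^ 2) := by
    rw [← Complex.ofReal_neg, Complex.re_ofReal_mul, sq, Complex.mul_re]; ring
  rw [hexp]
  have h1 : κ * (3 / 4 * X ^ 2 - 3 * r * X) ≤ κ * ((v + z).re ^ 2 - (v + z).im ^ 2) := by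
    refine mul_le_mul_of_nonneg_left ?_ hκ.le
    nlinarith
  nlinarith [mul_le_mul_of_nonneg_right hX2 (show 0 ≤ X by linarith)]

/-- The factor is identically `1` at `κ = 0`, and compactness of the disc makes continuity in `κ`
uniform. Such a factor barely alters a function on its own disc. -/
theorem exists_gaussian_near_one {r η : ℝ} (hη : 0 < η) :
    ∃ κ : ℝ, 0 < κ ∧ ∀ z : ℂ, ‖z‖ ≤ r → ‖Complex.exp (-κ * z ^ 2) - 1‖ ≤ η := by
  have hK : IsCompact (Metric.closedBall (0 : ℂ) r) := isCompact_closedBall _ _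
  have hev : ∀ᶠ κ : ℝ in 𝓝 0, ∀ z ∈ Metric.closedBall (0 : ℂ) r,
      ‖Complex.exp (-κ * z ^ 2) - 1‖ < η := by
    refine hK.eventually_forall_of_forall_eventually fun z _ => ?_
    have hc : Continuous fun q : ℝ × ℂ => ‖Complex.exp (-q.1 * q.2 ^ 2) - 1‖ := by fun_prop
    refine (hc.tendsto (0, z)).eventually_lt_const ?_
    simpa using hη
  obtain ⟨κ, h, hκ⟩ := ((hev.filter_mono nhdsWithin_le_nhds).and
    (self_mem_nhdsWithin (s := Set.Ioi (0 : ℝ)))).exists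
  exact ⟨κ, hκ, fun z hz => (h z (by simpa using hz)).le⟩

/-- Entire functions of bounded exponential size can be simultaneously approximated on discs
centred at sufficiently spaced points aligned along the real direction. -/
theorem exists_entire_approx_on_spaced_discs {C r ε : ℝ} (hC : 0 < C) (hr : 0 ≤ r) (hε : 0 < ε) :
    ∃ S : ℝ, 1 ≤ S ∧ ∀ (n : ℕ) (w : ℕ → ℂ) (F : ℕ → ℂ → ℂ),
      (∀ i, Differentiable ℂ (F i)) → (∀ i z, ‖F i z‖ ≤ C * Real.exp ‖z‖) →
      (∀ i j, i < j → j ≤ n → S * ((j : ℝ) - i) ≤ (w j - w i).re ∧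
        |(w j - w i).im| ≤ (w j - w i).re / 2) →
      ∃ f : ℂ → ℂ, Differentiable ℂ f ∧
        ∀ j ≤ n, ∀ z : ℂ, ‖z‖ ≤ r → ‖f (w j + z) - F j z‖ ≤ ε := by
  obtain ⟨B, hB, hBsum⟩ := exists_forall_sum_exp_neg_abs_le
  obtain ⟨κ, hκ, hκ1⟩ := exists_gaussian_near_one (r := r)
    (show 0 < ε / (2 * (C * Real.exp r)) by positivity)
  obtain ⟨X₀, hX₀⟩ := exists_exp_norm_mul_gaussian_le hκ hr
  have hlim : Tendsto (fun S : ℝ => C * Real.exp (1 - S) * B) atTop (𝓝 0) := by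
    have h : Tendsto (fun S : ℝ => Real.exp (1 - S)) atTop (𝓝 0) :=
      Real.tendsto_exp_atBot.comp (tendsto_atBot_add_const_left _ 1 tendsto_neg_atTop_atBot)
    simpa using (h.const_mul C).mul_const B
  -- `S` is fixed before the number of points: the bound `B` covers any finite family.
  obtain ⟨S, hSε, hSX, hS1⟩ := ((hlim.eventually_lt_const (half_pos hε)).and
    ((eventually_ge_atTop X₀).and (eventually_ge_atTop 1))).exists
  refine ⟨S, hS1, fun n w F hF hFC hw => ?_⟩
  have hsep : ∀ i ≤ n, ∀ j ≤ n, S * |(j : ℝ) - i| ≤ |(w j - w i).re| ∧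
      |(w j - w i).im| ≤ |(w j - w i).re| / 2 := by
    intro i hi j hj
    rcases lt_trichotomy i j with h | h | h
    · obtain ⟨h1, h2⟩ := hw i j h hj
      have hij : (0 : ℝ) < j - i := sub_pos.2 (by exact_mod_cast h)
      have h3 : 0 ≤ (w j - w i).re := le_trans (by positivity) h1
      rw [abs_of_pos hij, abs_of_nonneg h3]
      exact ⟨h1, h2⟩
    · subst h; simp
    · obtain ⟨h1, h2⟩ := hw j i h hi
      have hij : (0 : ℝ) < i - j := sub_pos.2 (by exact_mod_cast h)
      have h3 : 0 ≤ (w i - w j).re := le_trans (by positivity) h1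
      rw [abs_sub_comm, abs_of_pos hij, ← neg_sub (w i), Complex.neg_re, Complex.neg_im,
        abs_neg, abs_neg, abs_of_nonneg h3]
      exact ⟨h1, h2⟩
  refine ⟨fun z => ∑ i ∈ Finset.range (n + 1),
    F i (z - w i) * Complex.exp (-κ * (z - w i) ^ 2), ?_, fun j hj z hz => ?_⟩
  · refine Differentiable.fun_sum fun i _ => ?_
    have h1 : Differentiable ℂ fun z : ℂ => z - w i := by fun_prop
    exact ((hF i).comp h1).mul (by fun_prop)
  have hjmem : j ∈ Finset.range (n + 1) := Finset.mem_range.2 (by omega)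
  simp only
  rw [← Finset.add_sum_erase _ _ hjmem, add_sub_cancel_left]
  have hown : ‖F j z * Complex.exp (-κ * z ^ 2) - F j z‖ ≤ ε / 2 := by
    rw [show F j z * Complex.exp (-κ * z ^ 2) - F j z
      = F j z * (Complex.exp (-κ * z ^ 2) - 1) by ring, norm_mul]
    calc _ ≤ (C * Real.exp r) * (ε / (2 * (C * Real.exp r))) := by
          refine mul_le_mul ((hFC j z).trans ?_) (hκ1 z hz) (norm_nonneg _) (by positivity)
          gcongr
      _ = ε / 2 := by field_simp
  have hoff : ∀ i ∈ (Finset.range (n + 1)).erase j,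
      ‖F i (w j + z - w i) * Complex.exp (-κ * (w j + z - w i) ^ 2)‖ ≤
        C * Real.exp (1 - S) * Real.exp (-|(j : ℝ) - i|) := by
    intro i hi
    rw [Finset.mem_erase, Finset.mem_range] at hi
    obtain ⟨h1, h2⟩ := hsep i (by omega) j hj
    have hij : 1 ≤ |(j : ℝ) - i| := by
      have : (1 : ℤ) ≤ |(j : ℤ) - i| := Int.one_le_abs (by omega)
      exact_mod_cast this
    have h3 := hX₀ (w j - w i) z (by nlinarith) h2 hz
    rw [show w j + z - w i = w j - w i + z by ring, norm_mul]
    calc _ ≤ C * Real.exp ‖w j - w i + z‖ * ‖Complex.exp (-κ * (w j - w i + z) ^ 2)‖ :=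
          mul_le_mul_of_nonneg_right (hFC i _) (norm_nonneg _)
      _ = C * (Real.exp ‖w j - w i + z‖ * ‖Complex.exp (-κ * (w j - w i + z) ^ 2)‖) := by ring
      _ ≤ C * Real.exp (-|(w j - w i).re|) := mul_le_mul_of_nonneg_left h3 hC.le
      -- For `|j - i| ≥ 1` and `S ≥ 1`, `S * |j - i| ≥ (S - 1) + |j - i|`.
      _ ≤ C * (Real.exp (1 - S) * Real.exp (-|(j : ℝ) - i|)) := by
          rw [← Real.exp_add]
          gcongr
          nlinarith
      _ = _ := by ring
  have hsum := (norm_sum_le_of_le _ hoff).trans_eq (Finset.mul_sum _ _ _).symm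
  have hb := mul_le_mul_of_nonneg_left (hBsum ((Finset.range (n + 1)).erase j) j)
    (show 0 ≤ C * Real.exp (1 - S) by positivity)
  calc _ ≤ ‖F j z * Complex.exp (-κ * z ^ 2) - F j z‖ + ‖∑ i ∈ (Finset.range (n + 1)).erase j,
        F i (w j + z - w i) * Complex.exp (-κ * (w j + z - w i) ^ 2)‖ := by
        refine le_trans (le_of_eq ?_) (norm_add_le _ _)
        congr 1
        ring
    _ ≤ ε := by linarith

/-- The gluing needs exponential growth, which arbitrary entire functions lack; they are therefore
replaced by Taylor polynomials. -/
theorem Polynomial.exists_norm_eval_le_exp (p : Polynomial ℂ) :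
    ∃ C > 0, ∀ z : ℂ, ‖p.eval z‖ ≤ C * Real.exp ‖z‖ := by
  induction p using Polynomial.induction_on' with
  | add p q hp hq =>
    obtain ⟨C, hC, h⟩ := hp
    obtain ⟨D, hD, h'⟩ := hq
    refine ⟨C + D, by positivity, fun z => ?_⟩
    rw [Polynomial.eval_add, add_mul]
    exact (norm_add_le _ _).trans (add_le_add (h z) (h' z))
  | monomial n a =>
    refine ⟨‖a‖ * n.factorial + 1, by positivity, fun z => ?_⟩
    rw [Polynomial.eval_monomial, norm_mul, norm_pow]
    have h := Real.pow_div_factorial_le_exp ‖z‖ (norm_nonneg z) n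
    rw [div_le_iff₀ (by positivity)] at h
    have h1 := mul_le_mul_of_nonneg_left h (norm_nonneg a)
    have h2 := Real.exp_pos ‖z‖
    nlinarith

theorem Differentiable.exists_polynomial_near {f : ℂ → ℂ} (hf : Differentiable ℂ f) (r : ℝ)
    {ε : ℝ} (hε : 0 < ε) : ∃ p : Polynomial ℂ, ∀ z : ℂ, ‖z‖ ≤ r → ‖f z - p.eval z‖ < ε := by
  obtain ⟨P, h⟩ : ∃ P, HasFPowerSeriesOnBall f P 0 ⊤ :=
    ⟨_, hf.hasFPowerSeriesOnBall 0 (R := 1) one_pos⟩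
  have hu := h.tendstoUniformlyOn' (r' := r.toNNReal + 1) ENNReal.coe_lt_top
  obtain ⟨n, hn⟩ := (Metric.tendstoUniformlyOn_iff.1 hu ε hε).exists
  refine ⟨∑ k ∈ Finset.range n,
    Polynomial.C (P.coeff k) * Polynomial.X ^ k, fun z hz => ?_⟩
  have hz' : z ∈ Metric.ball (0 : ℂ) ((r.toNNReal + 1 : NNReal) : ℝ) := by
    rw [mem_ball_zero_iff]
    push_cast
    have := Real.le_coe_toNNReal r
    linarith
  have := hn z hz'
  rw [dist_eq_norm] at this
  have heq : (∑ k ∈ Finset.range n, Polynomial.C (P.coeff k) * Polynomial.X ^ k).eval z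
      = P.partialSum n (z - 0) := by
    rw [Polynomial.eval_finsetSum, FormalMultilinearSeries.partialSum, sub_zero]
    refine Finset.sum_congr rfl fun k _ => ?_
    rw [FormalMultilinearSeries.apply_eq_pow_smul_coeff, Polynomial.eval_mul, Polynomial.eval_C,
      Polynomial.eval_X_pow, smul_eq_mul, mul_comm]
  rwa [heq]

/-! ### Spiral points and their approximation by dilates -/

/-- The points `w j` sample a logarithmic spiral so that every slope `τ` is met. -/
theorem exists_spiral_points {S δ : ℝ} (hS : 1 ≤ S) (hδ : 0 < δ) :
    ∃ Q : ℝ, 1 ≤ Q ∧ ∀ ρ₀ : ℝ, S ≤ ρ₀ → ∃ (n : ℕ) (w : ℕ → ℂ), w 0 = 0 ∧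
      (∀ i j, i < j → j ≤ n → S * ((j : ℝ) - i) ≤ (w j - w i).re ∧
        |(w j - w i).im| ≤ (w j - w i).re / 2) ∧
      ∀ τ : ℝ, |τ| ≤ 1 / 8 → ∃ j ≤ n, j ≠ 0 ∧ ∃ ρ σ : ℝ, ρ₀ ≤ ρ ∧ ρ ≤ Q * ρ₀ ∧
        w j = ⟨ρ, ρ * σ⟩ ∧ ρ * |τ - σ| ≤ δ := by
  -- `c * S ≤ δ` bounds the displacement caused by sampling radii at step `S`; `c ≤ 1 / 8` keeps the
  -- increments between spiral points in the cone.
  set c : ℝ := min (δ / S) (1 / 8) with hc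
  have hS0 : 0 < S := by linarith
  have hc0 : 0 < c := lt_min (by positivity) (by norm_num)
  have hc8 : c ≤ 1 / 8 := min_le_right _ _
  have hcS : c * S ≤ δ := (le_div_iff₀ hS0).1 (min_le_left _ _)
  -- The slope `-1/8 + c * log (ρ / ρ₀)` reaches `1/8` exactly at `ρ = Q * ρ₀`.
  set Q := Real.exp (1 / (4 * c)) with hQ
  have hQ1 : 1 ≤ Q := Real.one_le_exp (by positivity)
  refine ⟨Q, hQ1, fun ρ₀ hρ₀ => ?_⟩
  have hρ0 : 0 < ρ₀ := by linarith
  set σ : ℝ → ℝ := fun ρ => -1 / 8 + c * Real.log (ρ / ρ₀) with hσ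
  have hσabs : ∀ ρ, ρ₀ ≤ ρ → ρ ≤ Q * ρ₀ → |σ ρ| ≤ 1 / 8 := by
    intro ρ h1 h2
    have h3 : 0 ≤ Real.log (ρ / ρ₀) := Real.log_nonneg ((one_le_div hρ0).2 h1)
    have h4 : Real.log (ρ / ρ₀) ≤ 1 / (4 * c) := by
      rw [Real.log_le_iff_le_exp (by have := hρ0.trans_le h1; positivity)]
      exact (div_le_iff₀ hρ0).2 h2
    have h5 : c * Real.log (ρ / ρ₀) ≤ 1 / 4 := by
      calc _ ≤ c * (1 / (4 * c)) := mul_le_mul_of_nonneg_left h4 hc0.le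
        _ = 1 / 4 := by field_simp
    rw [abs_le]
    constructor <;> simp only [hσ] <;> nlinarith
  have hσdiff : ∀ ρ ρ', ρ₀ ≤ ρ → ρ ≤ ρ' →
      0 ≤ σ ρ' - σ ρ ∧ ρ * (σ ρ' - σ ρ) ≤ c * (ρ' - ρ) := by
    intro ρ ρ' h1 h2
    have hρ : 0 < ρ := hρ0.trans_le h1
    have hρ' : 0 < ρ' := hρ.trans_le h2
    have heq : σ ρ' - σ ρ = c * Real.log (ρ' / ρ) := by
      simp only [hσ]
      rw [Real.log_div hρ'.ne' hρ0.ne', Real.log_div hρ.ne' hρ0.ne', Real.log_div hρ'.ne' hρ.ne']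
      ring
    rw [heq]
    refine ⟨mul_nonneg hc0.le (Real.log_nonneg ((one_le_div hρ).2 h2)), ?_⟩
    have hl := Real.log_le_sub_one_of_pos (show 0 < ρ' / ρ by positivity)
    calc ρ * (c * Real.log (ρ' / ρ)) ≤ ρ * (c * (ρ' / ρ - 1)) := by gcongr
      _ = c * (ρ' - ρ) := by field_simp
  set ρ : ℕ → ℝ := fun j => ρ₀ + j * S with hρdef
  have hρge : ∀ j, ρ₀ ≤ ρ j := fun j => by
    have : 0 ≤ (j : ℝ) * S := by positivity
    simp only [hρdef]; linarith
  set N := ⌊(Q - 1) * ρ₀ / S⌋₊ with hN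
  have hρle : ∀ j ≤ N, ρ j ≤ Q * ρ₀ := by
    intro j hj
    have h1 : (j : ℝ) ≤ (Q - 1) * ρ₀ / S :=
      (Nat.le_floor_iff (div_nonneg (mul_nonneg (by linarith) hρ0.le) hS0.le)).1 hj
    rw [le_div_iff₀ hS0] at h1
    simp only [hρdef]; linarith
  refine ⟨N + 1, fun j => match j with
    | 0 => 0
    | j + 1 => ⟨ρ j, ρ j * σ (ρ j)⟩, rfl, ?_, ?_⟩
  · intro i j hij hj
    obtain ⟨j, rfl⟩ : ∃ j', j = j' + 1 := ⟨j - 1, by omega⟩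
    have hjN : j ≤ N := by omega
    have ha := hσabs (ρ j) (hρge j) (hρle j hjN)
    cases i with
    | zero =>
      simp only [sub_zero, abs_mul, abs_of_pos (hρ0.trans_le (hρge j))]
      push_cast
      have := hρge j
      constructor
      · simp only [hρdef]; nlinarith
      · nlinarith [mul_le_mul_of_nonneg_left ha (hρ0.le.trans this)]
    | succ i =>
      have hij' : i < j := by omega
      have hijr : (i : ℝ) ≤ j := by exact_mod_cast hij'.le
      have hmono : ρ i ≤ ρ j := by simp only [hρdef]; nlinarith
      obtain ⟨h1, h2⟩ := hσdiff (ρ i) (ρ j) (hρge i) hmono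
      simp only [Complex.sub_re, Complex.sub_im]
      constructor
      · simp only [hρdef]; push_cast; apply le_of_eq; ring
      · have heq : ρ j * σ (ρ j) - ρ i * σ (ρ i)
            = (ρ j - ρ i) * σ (ρ j) + ρ i * (σ (ρ j) - σ (ρ i)) := by ring
        have hρi : 0 ≤ ρ i := hρ0.le.trans (hρge i)
        rw [heq]
        refine (abs_add_le _ _).trans ?_
        rw [abs_mul, abs_of_nonneg (sub_nonneg.2 hmono), abs_of_nonneg (mul_nonneg hρi h1)]
        nlinarith [mul_le_mul_of_nonneg_left ha (sub_nonneg.2 hmono),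
          mul_le_mul_of_nonneg_right hc8 (sub_nonneg.2 hmono)]
  · intro τ hτ
    obtain ⟨hτ1, hτ2⟩ := abs_le.1 hτ
    set ρs := ρ₀ * Real.exp ((τ + 1 / 8) / c) with hρs
    have hge : ρ₀ ≤ ρs := le_mul_of_one_le_right hρ0.le
      (Real.one_le_exp (div_nonneg (by linarith) hc0.le))
    have hle : ρs ≤ Q * ρ₀ := by
      rw [hρs, mul_comm]
      refine mul_le_mul_of_nonneg_right (Real.exp_le_exp.2 ?_) hρ0.le
      rw [div_le_div_iff₀ hc0 (by positivity)]
      nlinarith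
    have hστ : σ ρs = τ := by
      simp only [hσ, hρs]
      rw [mul_div_cancel_left₀ _ hρ0.ne', Real.log_exp]
      field_simp
      ring
    set j := ⌊(ρs - ρ₀) / S⌋₊ with hj
    have hjle : (j : ℝ) ≤ (ρs - ρ₀) / S := Nat.floor_le (div_nonneg (by linarith) hS0.le)
    have hjlt : (ρs - ρ₀) / S < j + 1 := Nat.lt_floor_add_one _
    rw [le_div_iff₀ hS0] at hjle
    rw [div_lt_iff₀ hS0] at hjlt
    have hjN : j ≤ N := by
      refine Nat.floor_le_floor ?_
      gcongr
      linarith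
    refine ⟨j + 1, by omega, by omega, ρ j, σ (ρ j), hρge j, hρle j hjN, rfl, ?_⟩
    have hρj : ρ j ≤ ρs := by simp only [hρdef]; linarith
    obtain ⟨h1, h2⟩ := hσdiff (ρ j) ρs (hρge j) hρj
    rw [hστ] at h1 h2
    rw [abs_of_nonneg h1]
    refine (h2.trans (mul_le_mul_of_nonneg_left ?_ hc0.le)).trans hcS
    simp only [hρdef]; linarith

/-- A compact conical neighbourhood of `1`. -/
def coneNhdOne : Set ℂ := {b | 1 / 2 ≤ b.re ∧ b.re ≤ 2 ∧ |b.im| ≤ b.re / 8}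

theorem exists_dilates_near_spiral {M : ℝ} (hM : 1 < M) {S δ : ℝ} (hS : 1 ≤ S) (hδ : 0 < δ) :
    ∃ (n : ℕ) (w : ℕ → ℂ), w 0 = 0 ∧
      (∀ i j, i < j → j ≤ n → S * ((j : ℝ) - i) ≤ (w j - w i).re ∧
        |(w j - w i).im| ≤ (w j - w i).re / 2) ∧
      ∀ b ∈ coneNhdOne, ∃ j ≤ n, j ≠ 0 ∧ ∃ m, ‖(sqrtBlockSeq M m : ℂ) * b - w j‖ ≤ δ := by
  obtain ⟨Q, hQ1, hQ⟩ := exists_spiral_points hS (half_pos hδ)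
  -- Since `1/2 ≤ b.re ≤ 2` and the inner radius is `2 s` with `s = blockStart M k`, the lengths `ρ
  -- / b.re` lie in `[s, 4 Q s]`. The bound `16 / δ` makes the error `b.re ^ 2 / ρ` at most `δ / 4`.
  obtain ⟨k, hk⟩ := exists_nat_ge (max (4 * Q) (max S (16 / δ)))
  rw [max_le_iff, max_le_iff] at hk
  obtain ⟨hkQ, hkS, hkδ⟩ := hk
  have hsk : (k : ℝ) ≤ blockStart M k := by exact_mod_cast (blockStart_strictMono hM).id_le k
  obtain ⟨n, w, hw0, hw, hcov⟩ := hQ (2 * blockStart M k) (by linarith)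
  refine ⟨n, w, hw0, hw, fun b hb => ?_⟩
  obtain ⟨hb1, hb2, hb3⟩ := hb
  have hx : 0 < b.re := by linarith
  obtain ⟨j, hj, hj0, ρ, σ, hρ1, hρ2, hwj, hσ⟩ := hcov (b.im / b.re) (by
    rw [abs_div, abs_of_pos hx, div_le_iff₀ hx]; linarith)
  have hρ : 0 < ρ := by linarith
  obtain ⟨m, hm⟩ := exists_sqrtBlockSeq_near hM (k := k) (y := ρ / b.re)
    ((le_div_iff₀ hx).2 (by nlinarith)) ((div_le_iff₀ hx).2 (by
      have h1 : (4 * Q) * (blockStart M k * b.re) ≤ (k + 2) * (blockStart M k * b.re) :=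
        mul_le_mul_of_nonneg_right (by linarith) (by positivity)
      have h2 : Q * blockStart M k * (1 / 2) ≤ Q * blockStart M k * b.re :=
        mul_le_mul_of_nonneg_left hb1 (by positivity)
      linarith))
  refine ⟨j, hj, hj0, m, ?_⟩
  set l := sqrtBlockSeq M m
  have hre : |l * b.re - ρ| ≤ δ / 4 := by
    have h1 : l * b.re - ρ = (l - ρ / b.re) * b.re := by field_simp
    rw [h1, abs_mul, abs_of_pos hx]
    calc _ ≤ 1 / (ρ / b.re) * b.re := mul_le_mul_of_nonneg_right hm hx.le
      _ = b.re ^ 2 / ρ := by field_simp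
      _ ≤ δ / 4 := by
        rw [div_le_iff₀ hρ]
        have h2 : 16 ≤ (k : ℝ) * δ := (div_le_iff₀ hδ).1 hkδ
        have h3 : (k : ℝ) * δ ≤ ρ * δ := mul_le_mul_of_nonneg_right (by linarith) hδ.le
        nlinarith
  have him : |l * b.im - ρ * σ| ≤ δ / 4 + δ / 2 := by
    have h1 : l * b.im - ρ * σ
        = (l * b.re - ρ) * (b.im / b.re) + ρ * (b.im / b.re - σ) := by field_simp; ring
    have h2 : |b.im / b.re| ≤ 1 := by
      rw [abs_div, abs_of_pos hx, div_le_iff₀ hx]; linarith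
    rw [h1]
    refine (abs_add_le _ _).trans (add_le_add ?_ ?_)
    · rw [abs_mul]
      exact (mul_le_of_le_one_right (abs_nonneg _) h2).trans hre
    · rwa [abs_mul, abs_of_pos hρ]
  refine (Complex.norm_le_abs_re_add_abs_im _).trans ?_
  rw [hwj]
  simp only [Complex.sub_re, Complex.sub_im, Complex.re_ofReal_mul, Complex.im_ofReal_mul]
  linarith

/-! ### Approximation along all directions of a cone -/

theorem exists_entire_approx_polynomials {M : ℝ} (hM : 1 < M) (p q : Polynomial ℂ) {r ε : ℝ}
    (hr : 0 ≤ r) (hε : 0 < ε) :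
    ∃ f : ℂ → ℂ, Differentiable ℂ f ∧ (∀ z : ℂ, ‖z‖ ≤ r → ‖f z - p.eval z‖ ≤ ε) ∧
      ∀ b ∈ coneNhdOne, ∃ m, ∀ z : ℂ, ‖z‖ ≤ r →
        ‖f (z + sqrtBlockSeq M m * b) - q.eval z‖ ≤ ε := by
  obtain ⟨C, hC, hpC⟩ := p.exists_norm_eval_le_exp
  obtain ⟨D, hD, hqD⟩ := q.exists_norm_eval_le_exp
  obtain ⟨δ, hδ, hqδ⟩ := Metric.uniformContinuousOn_iff_le.1
    ((isCompact_closedBall (0 : ℂ) (r + 1)).uniformContinuousOn_of_continuous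
      q.continuous.continuousOn) (ε / 2) (half_pos hε)
  -- The radius `r + 1` leaves room for the offset between `sqrtBlockSeq M m * b` and `w j`, which
  -- uniform continuity of `q` then absorbs.
  obtain ⟨S, hS, happ⟩ := exists_entire_approx_on_spaced_discs (C := C + D) (r := r + 1)
    (by positivity) (by linarith) (half_pos hε)
  obtain ⟨n, w, hw0, hw, hcov⟩ := exists_dilates_near_spiral hM hS (lt_min hδ one_pos)
  -- The point `w 0 = 0` carries `p`; every spiral point carries `q`.
  obtain ⟨f, hf, hfw⟩ := happ n w (fun i z => if i = 0 then p.eval z else q.eval z)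
    (fun i => by by_cases h : i = 0 <;> simp [h, Polynomial.differentiable])
    (fun i z => by
      by_cases h : i = 0 <;> simp only [h, if_true, if_false]
      · exact (hpC z).trans (by gcongr; linarith)
      · exact (hqD z).trans (by gcongr; linarith)) hw
  refine ⟨f, hf, fun z hz => ?_, fun b hb => ?_⟩
  · have := hfw 0 (Nat.zero_le n) z (by linarith)
    simp only [hw0, zero_add, if_true] at this
    linarith
  · obtain ⟨j, hj, hj0, m, hm⟩ := hcov b hb
    refine ⟨m, fun z hz => ?_⟩
    set u : ℂ := z + (sqrtBlockSeq M m * b - w j) with hu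
    have huz : ‖u - z‖ ≤ min δ 1 := by rw [hu, add_sub_cancel_left]; exact hm
    have hur : ‖u‖ ≤ r + 1 := by
      have := norm_add_le z (u - z)
      rw [add_sub_cancel] at this
      linarith [huz.trans (min_le_right _ _)]
    have h1 := hfw j hj u hur
    simp only [hj0, if_false] at h1
    have h2 := hqδ u (by simpa using hur) z (by simpa using by linarith)
      (by rw [dist_eq_norm]; exact huz.trans (min_le_left _ _))
    rw [dist_eq_norm] at h2
    have h3 : z + sqrtBlockSeq M m * b = w j + u := by rw [hu]; ring
    rw [h3]
    have := norm_sub_le_norm_sub_add_norm_sub (f (w j + u)) (q.eval u) (q.eval z)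
    linarith

theorem exists_entire_approx {M : ℝ} (hM : 1 < M) {g h : ℂ → ℂ} (hg : Differentiable ℂ g)
    (hh : Differentiable ℂ h) {r ε : ℝ} (hr : 0 ≤ r) (hε : 0 < ε) :
    ∃ f : ℂ → ℂ, Differentiable ℂ f ∧ (∀ z : ℂ, ‖z‖ ≤ r → ‖f z - g z‖ < ε) ∧
      ∀ b ∈ coneNhdOne, ∃ m, ∀ z : ℂ, ‖z‖ ≤ r →
        ‖f (z + sqrtBlockSeq M m * b) - h z‖ < ε := by
  obtain ⟨p, hp⟩ := hg.exists_polynomial_near r (half_pos hε)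
  obtain ⟨q, hq⟩ := hh.exists_polynomial_near r (half_pos hε)
  obtain ⟨f, hf, hfp, hfq⟩ := exists_entire_approx_polynomials hM p q hr (half_pos hε)
  have key : ∀ a b c : ℂ, ‖a - b‖ ≤ ε / 2 → ‖c - b‖ < ε / 2 → ‖a - c‖ < ε := by
    intro a b c h1 h2
    have := norm_sub_le_norm_sub_add_norm_sub a b c
    rw [norm_sub_rev b c] at this
    linarith
  refine ⟨f, hf, fun z hz => key _ _ _ (hfp z hz) (hp z hz), fun b hb => ?_⟩
  obtain ⟨m, hm⟩ := hfq b hb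
  exact ⟨m, fun z hz => key _ _ _ (hm z hz) (hq z hz)⟩

/-- The approximation in a conical neighbourhood of an arbitrary `c ≠ 0`. -/
theorem exists_entire_approx_smul {M : ℝ} (hM : 1 < M) {c : ℂ} (hc : c ≠ 0) {g h : ℂ → ℂ}
    (hg : Differentiable ℂ g) (hh : Differentiable ℂ h) {r ε : ℝ} (hr : 0 ≤ r) (hε : 0 < ε) :
    ∃ f : ℂ → ℂ, Differentiable ℂ f ∧ (∀ z : ℂ, ‖z‖ ≤ r → ‖f z - g z‖ < ε) ∧
      ∀ b ∈ coneNhdOne, ∃ m, ∀ z : ℂ, ‖z‖ ≤ r →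
        ‖f (z + sqrtBlockSeq M m * (c * b)) - h z‖ < ε := by
  have hmul : Differentiable ℂ fun z : ℂ => c * z := by fun_prop
  have hdiv : Differentiable ℂ fun z : ℂ => z / c := by fun_prop
  obtain ⟨f, hf, hfg, hfh⟩ := exists_entire_approx hM (hg.comp hmul) (hh.comp hmul)
    (div_nonneg hr (norm_nonneg c)) hε
  have hz : ∀ z : ℂ, ‖z‖ ≤ r → ‖z / c‖ ≤ r / ‖c‖ := fun z hz => by
    rw [norm_div]; gcongr
  -- Rescaling by `c` turns translation by `λ * (c * b)` into translation by `λ * b`.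
  refine ⟨fun z => f (z / c), hf.comp hdiv, fun z h => ?_, fun b hb => ?_⟩
  · simpa [mul_div_cancel₀ _ hc] using hfg (z / c) (hz z h)
  · obtain ⟨m, hm⟩ := hfh b hb
    refine ⟨m, fun z h => ?_⟩
    have := hm (z / c) (hz z h)
    rw [Function.comp_apply, mul_div_cancel₀ _ hc] at this
    simp only
    rwa [show (z + sqrtBlockSeq M m * (c * b)) / c = z / c + sqrtBlockSeq M m * b by
      field_simp]

theorem coneNhdOne_mem_nhds : coneNhdOne ∈ 𝓝 (1 : ℂ) := by
  have h1 : ∀ᶠ b : ℂ in 𝓝 1, (1 / 2 : ℝ) < b.re :=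
    Complex.continuous_re.continuousAt.eventually_const_lt (by norm_num)
  have h2 : ∀ᶠ b : ℂ in 𝓝 1, b.re < 2 :=
    Complex.continuous_re.continuousAt.eventually_lt_const (by norm_num)
  have h3 : ∀ᶠ b : ℂ in 𝓝 1, |b.im| - b.re / 8 < 0 :=
    (show Continuous fun b : ℂ => |b.im| - b.re / 8 by
      fun_prop).continuousAt.eventually_lt_const (by norm_num)
  filter_upwards [h1, h2, h3] with b hb1 hb2 hb3
  exact ⟨hb1.le, hb2.le, by linarith⟩

theorem isCompact_coneNhdOne : IsCompact coneNhdOne := by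
  refine Metric.isCompact_of_isClosed_isBounded ?_ ?_
  · exact (isClosed_le continuous_const Complex.continuous_re).inter
      ((isClosed_le Complex.continuous_re continuous_const).inter
        (isClosed_le Complex.continuous_im.abs (Complex.continuous_re.div_const 8)))
  · refine isBounded_iff_forall_norm_le.2 ⟨4, fun b hb => ?_⟩
    obtain ⟨h1, h2, h3⟩ := hb
    have := Complex.norm_le_abs_re_add_abs_im b
    rw [abs_of_nonneg (by linarith : 0 ≤ b.re)] at this
    linarith

theorem zero_notMem_coneNhdOne : (0 : ℂ) ∉ coneNhdOne := fun h => by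
  have := h.1
  norm_num at this

theorem image_mul_coneNhdOne_mem_nhds {c : ℂ} (hc : c ≠ 0) :
    (fun b => c * b) '' coneNhdOne ∈ 𝓝 c := by
  have h := (Homeomorph.mulLeft₀ c hc).isOpenMap.image_mem_nhds coneNhdOne_mem_nhds
  simpa using h

/-- Countably many dilates of the cone neighbourhood cover the punctured plane. -/
theorem exists_countable_coneNhd_cover : ∃ t : Set ℂ, t.Countable ∧ (∀ c ∈ t, c ≠ 0) ∧
    ∀ a : ℂ, a ≠ 0 → ∃ c ∈ t, ∃ b ∈ coneNhdOne, a = c * b := by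
  obtain ⟨t, hts, htc, ht⟩ := TopologicalSpace.countable_cover_nhdsWithin
    (s := {a : ℂ | a ≠ 0}) (f := fun c => (fun b => c * b) '' coneNhdOne)
    fun c hc => mem_nhdsWithin_of_mem_nhds (image_mul_coneNhdOne_mem_nhds hc)
  refine ⟨t, htc, hts, fun a ha => ?_⟩
  obtain ⟨c, hc, b, hb, h⟩ := Set.mem_iUnion₂.1 (ht ha)
  exact ⟨c, hc, b, hb, h.symm⟩

/-! ### Baire category in the space of entire functions -/

theorem isClosed_entireFunctions : IsClosed (EntireFunctions : Set C(ℂ, ℂ)) := by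
  refine isClosed_of_closure_subset fun f hf => ?_
  rw [mem_closure_iff_clusterPt, ClusterPt] at hf
  have h : Tendsto (fun g : C(ℂ, ℂ) => g) (𝓝 f ⊓ 𝓟 (EntireFunctions : Set C(ℂ, ℂ))) (𝓝 f) :=
    inf_le_left
  rw [ContinuousMap.tendsto_iff_tendstoLocallyUniformly] at h
  have := (tendstoLocallyUniformlyOn_univ.2 h).differentiableOn
    (Eventually.filter_mono inf_le_right <| eventually_principal.2 fun g hg =>
      (show Differentiable ℂ g from hg).differentiableOn) isOpen_univ
  exact differentiableOn_univ.1 this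

instance : BaireSpace EntireFunctions :=
  haveI := isClosed_entireFunctions.isCompletelyMetrizableSpace
  inferInstanceAs (BaireSpace (EntireFunctions : Set C(ℂ, ℂ)))

instance : SecondCountableTopology EntireFunctions :=
  Topology.IsEmbedding.subtypeVal.secondCountableTopology

theorem exists_ball_approx_of_mem_nhds {f : EntireFunctions} {V : Set EntireFunctions}
    (hV : V ∈ 𝓝 f) : ∃ r ε : ℝ, 0 ≤ r ∧ 0 < ε ∧
      ∀ g : EntireFunctions, (∀ z : ℂ, ‖z‖ ≤ r → ‖g.1 z - f.1 z‖ < ε) → g ∈ V := by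
  obtain ⟨U, hU, hUV⟩ := mem_nhds_subtype _ _ _ |>.1 hV
  obtain ⟨W, hW, hWU⟩ := UniformSpace.mem_nhds_iff.1 hU
  obtain ⟨K, E, hK, hE, hKE⟩ := (ContinuousMap.mem_compactConvergence_entourage_iff W).1 hW
  obtain ⟨ε, hε, hεE⟩ := Metric.mem_uniformity_dist.1 hE
  obtain ⟨r, hr, hrK⟩ := hK.isBounded.subset_closedBall_lt 0 0
  refine ⟨r, ε, hr.le, hε, fun g hg => hUV (hWU (hKE fun x hx => hεE ?_))⟩
  rw [dist_comm, dist_eq_norm]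
  exact hg x (by simpa using hrK hx)

theorem continuous_translationOp_uncurry :
    Continuous fun q : ℂ × EntireFunctions => translationOp q.1 q.2 := by
  refine Continuous.subtype_mk ?_ _
  refine ContinuousMap.continuous_of_continuous_uncurry _ ?_
  have h : Continuous fun x : (ℂ × EntireFunctions) × ℂ => (x.1.2.1, x.2 + x.1.1) := by fun_prop
  exact ContinuousEval.continuous_eval.comp h

/-- The functions having, for each `a ∈ K`, some translate along `(lam n * a)` in `U`. -/
def translatesMeet (lam : ℕ → ℂ) (K : Set ℂ) (U : Set EntireFunctions) : Set EntireFunctions :=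
  {f | ∀ a ∈ K, ∃ n, translationOp (lam n * a) f ∈ U}

/-- `(f, a) ↦ translationOp (lam n * a) f` is jointly continuous, so one `n` serves near each `(f,
a)`; compactness of `K` gives a common neighbourhood of `f`. -/
theorem isOpen_translatesMeet (lam : ℕ → ℂ) {K : Set ℂ} (hK : IsCompact K)
    {U : Set EntireFunctions} (hU : IsOpen U) : IsOpen (translatesMeet lam K U) := by
  refine isOpen_iff_eventually.2 fun f hf => ?_
  refine hK.eventually_forall_of_forall_eventually fun a ha => ?_
  obtain ⟨n, hn⟩ := hf a ha
  have hc : Continuous fun q : EntireFunctions × ℂ => translationOp (lam n * q.2) q.1 :=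
    continuous_translationOp_uncurry.comp
      ((continuous_const.mul continuous_snd).prodMk continuous_fst)
  exact ((hc.tendsto (f, a)).eventually (hU.mem_nhds hn)).mono fun q hq => ⟨n, hq⟩

theorem dense_translatesMeet {M : ℝ} (hM : 1 < M) {c : ℂ} (hc : c ≠ 0)
    {U : Set EntireFunctions} (hU : IsOpen U) (hne : U.Nonempty) :
    Dense (translatesMeet (fun n => (sqrtBlockSeq M n : ℂ)) ((fun b => c * b) '' coneNhdOne) U) := by
  refine dense_iff_inter_open.2 fun V hV ⟨g, hg⟩ => ?_
  obtain ⟨h, hh⟩ := hne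
  obtain ⟨r, ε, hr, hε, hVr⟩ := exists_ball_approx_of_mem_nhds (hV.mem_nhds hg)
  obtain ⟨s, η, -, hη, hUs⟩ := exists_ball_approx_of_mem_nhds (hU.mem_nhds hh)
  obtain ⟨f, hf, hfg, hfh⟩ := exists_entire_approx_smul hM hc (g := g.1) (h := h.1) g.2 h.2
    (hr.trans (le_max_left r s)) (lt_min hε hη)
  refine ⟨⟨⟨f, hf.continuous⟩, hf⟩, hVr _ fun z hz => ?_, ?_⟩
  · exact (hfg z (hz.trans (le_max_left _ _))).trans_le (min_le_left _ _)
  · rintro _ ⟨b, hb, rfl⟩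
    obtain ⟨m, hm⟩ := hfh b hb
    exact ⟨m, hUs _ fun z hz =>
      (hm z (hz.trans (le_max_right _ _))).trans_le (min_le_right _ _)⟩

/-- With `t` and the basis countable, this turns the uncountable intersection over `a` into a
countable one. The empty basic set is excluded because no translate can meet it. -/
theorem commonHypercyclicVectors_eq_biInter {lam : ℕ → ℂ} {t : Set ℂ} (ht0 : ∀ c ∈ t, c ≠ 0)
    (ht : ∀ a : ℂ, a ≠ 0 → ∃ c ∈ t, ∃ b ∈ coneNhdOne, a = c * b)
    {𝓑 : Set (Set EntireFunctions)} (h𝓑 : TopologicalSpace.IsTopologicalBasis 𝓑)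
    (h𝓑ne : ∅ ∉ 𝓑) :
    commonHypercyclicVectors lam = ⋂ x ∈ t ×ˢ 𝓑,
      translatesMeet lam ((fun b => x.1 * b) '' coneNhdOne) x.2 := by
  ext f
  simp only [commonHypercyclicVectors, Set.mem_iInter, Set.mem_prod, Prod.forall, and_imp]
  constructor
  · rintro h c U hc hU _ ⟨b, hb, rfl⟩
    have hb0 : b ≠ 0 := fun h => zero_notMem_coneNhdOne (h ▸ hb)
    have hd := h (c * b) (mul_ne_zero (ht0 c hc) hb0)
    have hUne : U.Nonempty := Set.nonempty_iff_ne_empty.2 fun h => h𝓑ne (h ▸ hU)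
    obtain ⟨_, hy, n, rfl⟩ := h𝓑.dense_iff.1 hd U hU hUne
    exact ⟨n, hy⟩
  · intro h a ha
    obtain ⟨c, hc, b, hb, rfl⟩ := ht a ha
    refine h𝓑.dense_iff.2 fun U hU _ => ?_
    obtain ⟨n, hn⟩ := h c U hc hU _ ⟨b, hb, rfl⟩
    exact ⟨_, hn, n, rfl⟩

theorem isGδ_and_dense_commonHypercyclicVectors {M : ℝ} (hM : 1 < M) :
    IsGδ (commonHypercyclicVectors fun n => (sqrtBlockSeq M n : ℂ)) ∧
      Dense (commonHypercyclicVectors fun n => (sqrtBlockSeq M n : ℂ)) := by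
  obtain ⟨t, htc, ht0, ht⟩ := exists_countable_coneNhd_cover
  obtain ⟨𝓑, h𝓑c, h𝓑ne, h𝓑⟩ := TopologicalSpace.exists_countable_basis EntireFunctions
  rw [commonHypercyclicVectors_eq_biInter ht0 ht h𝓑 h𝓑ne]
  have ho : ∀ x ∈ t ×ˢ 𝓑, IsOpen (translatesMeet (fun n => (sqrtBlockSeq M n : ℂ))
      ((fun b => x.1 * b) '' coneNhdOne) x.2) := fun x hx =>
    isOpen_translatesMeet _ (isCompact_coneNhdOne.image (continuous_const_mul x.1))
      (h𝓑.isOpen hx.2)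
  refine ⟨.biInter_of_isOpen (htc.prod h𝓑c) ho,
    dense_biInter_of_isOpen ho (htc.prod h𝓑c) fun x hx => ?_⟩
  exact dense_translatesMeet hM (ht0 _ hx.1) (h𝓑.isOpen hx.2)
    (Set.nonempty_iff_ne_empty.2 fun h => h𝓑ne (h ▸ hx.2))

theorem proposition6p1 (M : ℝ) (hM : 1 < M) :
    ∃ lam : ℕ → ℝ, StrictMono lam ∧ (∀ n, 0 < lam n) ∧ Tendsto lam atTop atTop ∧
      ratioIndex (fun n => (lam n : ℂ)) = ENNReal.ofReal M ∧
      ConditionSigma (fun n => (lam n : ℂ)) ∧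
      IsGδ (commonHypercyclicVectors fun n => (lam n : ℂ)) ∧
      Dense (commonHypercyclicVectors fun n => (lam n : ℂ)) :=
  ⟨sqrtBlockSeq M, sqrtBlockSeq_strictMono hM, sqrtBlockSeq_pos hM, tendsto_sqrtBlockSeq hM,
    ratioIndex_sqrtBlockSeq hM, conditionSigma_sqrtBlockSeq hM,
    isGδ_and_dense_commonHypercyclicVectors hM⟩
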